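/- Let $\mathcal I,\mathcal K$ be countable index sets, let $\ell_2$ denote real square-summable sequences, let $T:\ell_2(\mathcal I)\to\ell_2(\mathcal K)$ be bounded linear with $\|T\|<1$, and let $g\in\ell_2(\mathcal K)$, $r>0$. Let $p\ge 1$, and assume that $p\le 2$ or that $\mathcal I$ is finite. Put $$\mathcal J^p_r(u)=\|Tu-g\|^2+\sum_{i\in\mathcal I}\min\{|u_i|^p,r^p\}\in[0,\infty].$$ For $p>1$ let $F_p(t)=t+\frac p2\,\mathrm{sgn}(t)\,|t|^{p-1}$, a bijection of $\mathbb R$, and let $\lambda'=\lambda'(r,p)$ be the unique positive solution of $(F_p^{-1}(\lambda')-\lambda')^2+|F_p^{-1}(\lambda')|^p=r^p$; put $H_{(p,r)}(\lambda)=F_p^{-1}(\lambda)$ if $|\lambda|\le\lambda'$ and $H_{(p,r)}(\lambda)=\lambda$ if $|\lambda|>\lambda'$. For $p=1$ and $r>1/4$ let $\lambda'=r+1/4$ and $H_{(1,r)}(\lambda)=0$ if $|\lambda|\le 1/2$, $=(|\lambda|-1/2)\,\mathrm{sgn}\,\lambda$ if $1/2<|\lambda|\le\lambda'$, $=\lambda$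 if $|\lambda|>\lambda'$. For $p=1$ and $r\le 1/4$ let $\lambda'=\sqrt r$ and $H_{(1,r)}(\lambda)=0$ if $|\lambda|\le\lambda'$, $=\lambda$ if $|\lambda|>\lambda'$. In all cases let $\delta(r,p)=|\lambda'-H_{(p,r)}(\lambda')|$, and define $\mathbb H:\ell_2(\mathcal I)\to\ell_2(\mathcal I)$ by $[\mathbb H(u)]_i=H_{(p,r)}\big([u-T^*Tu+T^*g]_i\big)$. Let $u^0\in\ell_2(\mathcal I)$ with $\mathcal J^p_r(u^0)<\infty$. Then the sequence defined by $u^{n+1}=\mathbb H(u^n)$ converges weakly in $\ell_2(\mathcal I)$ to some $\bar u\in\ell_2(\mathcal I)$ that satisfies the following fixed point conditions. 0. For every $i$, either $[\mathbb H(\bar u)]_i=\bar u_i$, or $|\bar u_i|=\lambda'$ and $[T^*(g-T\bar u)]_i=0$. 1. If $|\bar u_i|>r$, then $|\bar u_i|\ge\lambda'(r,p)$. 2. If $p>1$ and $|\bar u_i|\le r$, then $|\bar u_i|\le F_p^{-1}(\lambda'(r,p))$. 3. (a) If $p>1$, then $[T^*(g-T\bar u)]_i=0$ whenever $|\bar u_i|\ge\lambda'(r,p)$,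 and $[T^*(g-T\bar u)]_i=F_p(\bar u_i)-\bar u_i$ whenever $|\bar u_i|\le\lambda'(r,p)-\delta(r,p)$. (b) If $p=1$ and $r\ge 1/4$, then $[T^*(g-T\bar u)]_i\in[-1/2,1/2]$ whenever $|\bar u_i|\le 1/2$; $[T^*(g-T\bar u)]_i=\frac12\,\mathrm{sgn}\,\bar u_i$ whenever $1/2<|\bar u_i|\le r-1/4$; and $[T^*(g-T\bar u)]_i=0$ whenever $|\bar u_i|>r+1/4$. -/

import Mathlib

open Filter Topology
open scoped ENNReal

noncomputable section

namespace FreeDiscontinuity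

/-- Real square-summable families, the Hilbert space `ℓ₂(ι)`. -/
abbrev L2 (ι : Type*) := lp (fun _ : ι => ℝ) 2

/-- The functional `‖T u - g‖² + ∑ i, min (|u i| ^ p) (r ^ p)`, with values in `[0, ∞]`
(in infinite dimensions and for `p < 2` the sum can be infinite). -/
def J {ι κ : Type*} (p r : ℝ) (T : L2 ι →L[ℝ] L2 κ) (g : L2 κ) (u : L2 ι) : ℝ≥0∞ :=
  ENNReal.ofReal (‖T u - g‖ ^ 2) + ∑' i, ENNReal.ofReal (min (|u i| ^ p) (r ^ p))

/-- `F_p(t) = t + (p/2) sgn(t) |t|^(p-1)`. -/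
def F (p t : ℝ) : ℝ := t + p / 2 * Real.sign t * |t| ^ (p - 1)

/-- The inverse function of `F p`; for `p > 1` the function `F p` is a bijection of `ℝ`
(see `F_bijective`). -/
def Finv (p : ℝ) : ℝ → ℝ := Function.invFun (F p)

/-- The equation that determines the position of the jump when `p > 1`. -/
def IsJump (p r l : ℝ) : Prop :=
  0 < l ∧ (Finv p l - l) ^ 2 + |Finv p l| ^ p = r ^ p

open Classical in
/-- The position `λ'(r, p)` of the jump. For `p > 1` it is the unique positive solution of
`(F_p⁻¹(l) - l)² + |F_p⁻¹(l)|^p = r^p` (see `existsUnique_isJump`). -/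
def jump (p r : ℝ) : ℝ :=
  if p = 1 then (if 1 / 4 < r then r + 1 / 4 else Real.sqrt r)
  else if h : ∃ l, IsJump p r l then h.choose else 0

open Classical in
/-- The thresholding function `H_(p,r)`. -/
def H (p r l : ℝ) : ℝ :=
  if p = 1 then
    if 1 / 4 < r then
      if |l| ≤ 1 / 2 then 0
      else if |l| ≤ jump 1 r then (|l| - 1 / 2) * Real.sign l
      else l
    else if |l| ≤ jump 1 r then 0 else l
  else if |l| ≤ jump p r then Finv p l else l

/-- The size of the jump, `δ(r, p) = |λ' - H_(p,r)(λ')|`. -/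
def jumpSize (p r : ℝ) : ℝ := |jump p r - H p r (jump p r)|

/-! Facts showing that the definitions above are meaningful. -/

theorem F_neg (p t : ℝ) : F p (-t) = -F p t := by
  simp only [F, Real.sign_neg, abs_neg]; ring

theorem F_of_nonneg {p : ℝ} (hp : 1 < p) {t : ℝ} (ht : 0 ≤ t) :
    F p t = t + p / 2 * t ^ (p - 1) := by
  rcases ht.eq_or_lt with rfl | h
  · simp [F, Real.zero_rpow (by linarith : p - 1 ≠ 0)]
  · simp [F, Real.sign_of_pos h, abs_of_pos h]

theorem F_surjective {p : ℝ} (hp : 1 < p) : Function.Surjective (F p) := by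
  have key : ∀ l : ℝ, 0 ≤ l → ∃ t, F p t = l := by
    intro l hl
    have hc : ContinuousOn (fun t : ℝ => t + p / 2 * t ^ (p - 1)) (Set.Icc 0 l) := by
      refine Continuous.continuousOn ?_
      exact continuous_id.add (continuous_const.mul
        (Real.continuous_rpow_const (by linarith)))
    have h0 : (0 : ℝ) + p / 2 * (0 : ℝ) ^ (p - 1) ≤ l := by
      simpa [Real.zero_rpow (by linarith : p - 1 ≠ 0)] using hl
    have h1 : l ≤ l + p / 2 * l ^ (p - 1) := by
      have : 0 ≤ p / 2 * l ^ (p - 1) := by positivity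
      linarith
    obtain ⟨t, ht, hft⟩ := intermediate_value_Icc hl hc ⟨h0, h1⟩
    exact ⟨t, by rw [F_of_nonneg hp ht.1]; exact hft⟩
  intro l
  rcases le_total 0 l with hl | hl
  · exact key l hl
  · obtain ⟨t, ht⟩ := key (-l) (by linarith)
    exact ⟨-t, by rw [F_neg, ht, neg_neg]⟩

theorem F_strictMono {p : ℝ} (hp : 1 < p) : StrictMono (F p) := by
  have key : ∀ s t : ℝ, 0 ≤ s → s < t → F p s < F p t := by
    intro s t hs hst
    rw [F_of_nonneg hp hs, F_of_nonneg hp (hs.trans hst.le)]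
    have : s ^ (p - 1) ≤ t ^ (p - 1) := Real.rpow_le_rpow hs hst.le (by linarith)
    have := mul_le_mul_of_nonneg_left this (by linarith : 0 ≤ p / 2)
    linarith
  have h0 : F p 0 = 0 := by rw [F_of_nonneg hp le_rfl]; simp [Real.zero_rpow (by linarith : p - 1 ≠ 0)]
  intro s t hst
  rcases le_or_gt 0 s with hs | hs
  · exact key s t hs hst
  rcases le_or_gt 0 t with ht | ht
  · have h1 := key 0 (-s) le_rfl (by linarith)
    rw [F_neg, h0] at h1
    have h2 : 0 ≤ F p t := by
      rcases ht.eq_or_lt with rfl | ht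
      · exact h0.ge
      · have := key 0 t le_rfl ht
        linarith
    linarith
  · have h1 := key (-t) (-s) (by linarith) (by linarith)
    rw [F_neg, F_neg] at h1
    linarith

theorem F_bijective {p : ℝ} (hp : 1 < p) : Function.Bijective (F p) :=
  ⟨(F_strictMono hp).injective, F_surjective hp⟩

theorem F_Finv {p : ℝ} (hp : 1 < p) (l : ℝ) : F p (Finv p l) = l :=
  Function.rightInverse_invFun (F_surjective hp) l

theorem Finv_F {p : ℝ} (hp : 1 < p) (t : ℝ) : Finv p (F p t) = t :=
  Function.leftInverse_invFun (F_strictMono hp).injective t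

theorem abs_le_abs_F {p : ℝ} (hp : 1 < p) (t : ℝ) : |t| ≤ |F p t| := by
  have key : ∀ t : ℝ, 0 ≤ t → |t| ≤ |F p t| := by
    intro t ht
    rw [F_of_nonneg hp ht, abs_of_nonneg ht, abs_of_nonneg (by positivity)]
    have : 0 ≤ p / 2 * t ^ (p - 1) := by positivity
    linarith
  rcases le_total 0 t with ht | ht
  · exact key t ht
  · have := key (-t) (by linarith)
    rwa [F_neg, abs_neg, abs_neg] at this

theorem existsUnique_isJump {p r : ℝ} (hp : 1 < p) (hr : 0 < r) : ∃! l, IsJump p r l := by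
  -- in the variable `t = F_p⁻¹(l)` the equation reads `(p/2)² (t^(p-1))² + t^p = r^p`
  set S : ℝ → ℝ := fun t => (p / 2 * t ^ (p - 1)) ^ 2 + t ^ p with hS
  have hSc : Continuous S :=
    ((continuous_const.mul (Real.continuous_rpow_const (by linarith))).pow 2).add
      (Real.continuous_rpow_const (by linarith))
  have hSm : ∀ s t : ℝ, 0 ≤ s → s < t → S s < S t := by
    intro s t hs hst
    have h1 : s ^ (p - 1) ≤ t ^ (p - 1) := Real.rpow_le_rpow hs hst.le (by linarith)
    have h2 : s ^ p < t ^ p := Real.rpow_lt_rpow hs hst (by linarith)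
    have h3 : p / 2 * s ^ (p - 1) ≤ p / 2 * t ^ (p - 1) :=
      mul_le_mul_of_nonneg_left h1 (by linarith)
    have h4 : 0 ≤ p / 2 * s ^ (p - 1) := by positivity
    have := pow_le_pow_left₀ h4 h3 2
    simp only [hS]; linarith
  have hS0 : S 0 = 0 := by
    simp [hS, Real.zero_rpow (by linarith : p - 1 ≠ 0), Real.zero_rpow (by linarith : p ≠ 0)]
  have hrp : 0 < r ^ p := Real.rpow_pos_of_pos hr p
  have hSF : ∀ t : ℝ, 0 ≤ t → (t - F p t) ^ 2 + |t| ^ p = S t := by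
    intro t ht
    rw [F_of_nonneg hp ht, abs_of_nonneg ht]; simp only [hS]; ring
  have hF0 : F p 0 = 0 := by
    rw [F_of_nonneg hp le_rfl]; simp [Real.zero_rpow (by linarith : p - 1 ≠ 0)]
  have hpos : ∀ l : ℝ, 0 < l → 0 < Finv p l := by
    intro l hl
    rw [← (F_strictMono hp).lt_iff_lt, hF0, F_Finv hp]; exact hl
  obtain ⟨t, ht, hSt⟩ := intermediate_value_Icc hr.le hSc.continuousOn
    (show r ^ p ∈ Set.Icc (S 0) (S r) by
      refine ⟨by rw [hS0]; exact hrp.le, ?_⟩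
      have : 0 ≤ (p / 2 * r ^ (p - 1)) ^ 2 := sq_nonneg _
      simp only [hS]; linarith)
  have ht0 : 0 < t := by
    rcases ht.1.eq_or_lt with h | h
    · rw [← h, hS0] at hSt; linarith
    · exact h
  refine ⟨F p t, ⟨?_, ?_⟩, ?_⟩
  · have := F_strictMono hp ht0
    rwa [hF0] at this
  · rw [Finv_F hp, hSF t ht0.le, hSt]
  · rintro l ⟨hl, he⟩
    have hl' := hpos l hl
    have h1 : S (Finv p l) = r ^ p := by
      rw [← hSF _ hl'.le, F_Finv hp]; exact he
    have : Finv p l = t := by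
      rcases lt_trichotomy (Finv p l) t with h | h | h
      · have := hSm _ _ hl'.le h; linarith
      · exact h
      · have := hSm _ _ ht0.le h; linarith
    rw [← this, F_Finv hp]

theorem isJump_jump {p r : ℝ} (hp : 1 < p) (hr : 0 < r) : IsJump p r (jump p r) := by
  have h : ∃ l, IsJump p r l := (existsUnique_isJump hp hr).exists
  unfold jump
  rw [if_neg (by linarith : p ≠ 1), dif_pos h]
  exact h.choose_spec

theorem abs_H_le {p : ℝ} (hp : 1 ≤ p) (r l : ℝ) : |H p r l| ≤ |l| := by
  unfold H
  split_ifs with h1 h2 h3 h4 h5 h6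
  · simp
  · rw [abs_mul]
    have hs : |Real.sign l| ≤ 1 := by
      rcases Real.sign_apply_eq l with h | h | h <;> simp [h]
    have ha : |(|l| - 1 / 2)| ≤ |l| := by rw [abs_of_nonneg (by linarith)]; linarith
    calc |(|l| - 1 / 2)| * |Real.sign l| ≤ |l| * 1 :=
          mul_le_mul ha hs (abs_nonneg _) (abs_nonneg _)
      _ = |l| := mul_one _
  · exact le_rfl
  · simp
  · exact le_rfl
  · have hp1 : 1 < p := lt_of_le_of_ne hp (Ne.symm h1)
    have := abs_le_abs_F hp1 (Finv p l)
    rwa [F_Finv hp1] at this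
  · exact le_rfl

/-- The residual correlation `T*(g - T u)`. -/
def corr {ι κ : Type*} (T : L2 ι →L[ℝ] L2 κ) (g : L2 κ) (u : L2 ι) : L2 ι :=
  ContinuousLinearMap.adjoint T (g - T u)

/-- The operator `ℍ` on `ℓ₂(ι)` that applies `H_(p,r)` to every component of
`u - T*T u + T*g`. -/
def thresholdMap {ι κ : Type*} (p r : ℝ) (hp : 1 ≤ p) (T : L2 ι →L[ℝ] L2 κ) (g : L2 κ)
    (u : L2 ι) : L2 ι :=
  ⟨fun i => H p r ((u - ContinuousLinearMap.adjoint T (T u)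
      + ContinuousLinearMap.adjoint T g) i),
    (lp.memℓp (u - ContinuousLinearMap.adjoint T (T u)
      + ContinuousLinearMap.adjoint T g)).mono' fun i => by
        simpa only [Real.norm_eq_abs] using abs_H_le hp r _⟩

end FreeDiscontinuity

end

/-!
The iteration is a majorization scheme. Componentwise, `H p r` minimizes
`t ↦ (t - l) ^ 2 + min (|t| ^ p) (r ^ p)` (`H_min`): the untruncated minimizer is the proximal map
`prox p`, and truncation replaces it by `l` itself as soon as the minimal value exceeds `r ^ p`,
which happens exactly beyond the jump. Summing over the components shows that one step minimizes
`J(v) + ‖v - u‖ ^ 2 - ‖T (v - u)‖ ^ 2`, so the energy decreases by at least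
`(1 - ‖T‖ ^ 2) * ‖v - u‖ ^ 2` (`energy_thresholdMap_le`) and consecutive iterates approach each
other.

The threshold map is discontinuous, but its values avoid the gap between `prox p (jump p r)` and
`jump p r`. Once the steps are shorter than this gap, no component can cross it, so the finite set
of components above the jump no longer changes (`exists_frozen`). From then on the iteration is
that of the map `frozenMap`, which is the gradient step on that set and its composition with the
proximal map elsewhere. This map is nonexpansive because the gradient step and `prox p` are.

Its orbit is bounded (`exists_norm_le_of_frozen`): outside the finite set the penalty controls the
norm, by `p ≤ 2` or by finiteness of the index set; inside it, the increments lie in a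
finite-dimensional space on which `T` is bounded below, while `‖T u‖` is controlled by the energy.
Opial's theorem (`exists_fixedPoint_of_nonexpansive`) then yields weak convergence to a fixed point
of the frozen map. As the components of the gradient step are weakly continuous, the inequalities
that separate the two kinds of components pass to the limit, and the fixed point conditions are read
off from them.
-/

noncomputable section

namespace FreeDiscontinuity

open scoped InnerProductSpace

/-! ### Nonexpansive and gradient iterations in Hilbert spaces -/

section Hilbert

variable {E E' : Type*} [NormedAddCommGroup E] [InnerProductSpace ℝ E] [CompleteSpace E]
  [NormedAddCommGroup E'] [InnerProductSpace ℝ E'] [CompleteSpace E']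

/-- Weak compactness of balls: along an ultrafilter every bounded sequence has a weak limit. Using
ultrafilters in place of subsequences makes separability of the space irrelevant. -/
theorem exists_weak_limit_of_ultrafilter {x : ℕ → E} {C : ℝ} (hC : ∀ n, ‖x n‖ ≤ C)
    (𝒰 : Ultrafilter ℕ) :
    ∃ q : E, ∀ y, Tendsto (fun n => ⟪x n, y⟫_ℝ) 𝒰 (𝓝 ⟪q, y⟫_ℝ) := by
  let φ : ℕ → WeakDual ℝ E := fun n => StrongDual.toWeakDual (InnerProductSpace.toDual ℝ E (x n))
  have hK := WeakDual.isCompact_closedBall (𝕜 := ℝ) (E := E) 0 C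
  obtain ⟨f, -, hf⟩ := hK.ultrafilter_le_nhds' (𝒰.map φ) (by
    refine Ultrafilter.mem_map.2 (Filter.Eventually.of_forall fun n => ?_)
    simp [φ, hC n])
  refine ⟨(InnerProductSpace.toDual ℝ E).symm f.toStrongDual, fun y => ?_⟩
  have h := ((WeakDual.eval_continuous (𝕜 := ℝ) y).tendsto f).comp
    (show Tendsto φ 𝒰 (𝓝 f) from hf)
  simpa [φ, Function.comp_def] using h

/-- **Opial's theorem**: a bounded, asymptotically regular orbit of a nonexpansive map of a
Hilbert space converges weakly to a fixed point. -/
theorem exists_fixedPoint_of_nonexpansive {N : E → E} (hN : ∀ x y, ‖N x - N y‖ ≤ ‖x - y‖)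
    {x : ℕ → E} (hx : ∀ n, x (n + 1) = N (x n)) {C : ℝ} (hC : ∀ n, ‖x n‖ ≤ C)
    (hreg : Tendsto (fun n => ‖x (n + 1) - x n‖) atTop (𝓝 0)) :
    ∃ q, N q = q ∧ ∀ y, Tendsto (fun n => ⟪x n, y⟫_ℝ) atTop (𝓝 ⟪q, y⟫_ℝ) := by
  -- Demiclosedness: every weak cluster point is a fixed point.
  have demi : ∀ (𝒰 : Ultrafilter ℕ), (𝒰 : Filter ℕ) ≤ atTop → ∀ q : E,
      (∀ y, Tendsto (fun n => ⟪x n, y⟫_ℝ) 𝒰 (𝓝 ⟪q, y⟫_ℝ)) → N q = q := by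
    intro 𝒰 h𝒰 q hq
    have hε := hreg.mono_left h𝒰
    have key : ∀ n, ‖q - N q‖ ^ 2 + 2 * (⟪x n, q - N q⟫_ℝ - ⟪q, q - N q⟫_ℝ)
        ≤ ‖x (n + 1) - x n‖ ^ 2 + 2 * (C + ‖q‖) * ‖x (n + 1) - x n‖ := by
      intro n
      have h1 : ‖x n - N q‖ ≤ ‖x (n + 1) - x n‖ + ‖x n - q‖ := by
        calc ‖x n - N q‖ = ‖(N (x n) - N q) - (x (n + 1) - x n)‖ := by rw [hx]; congr 1; abel
          _ ≤ ‖N (x n) - N q‖ + ‖x (n + 1) - x n‖ := norm_sub_le _ _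
          _ ≤ _ := by linarith [hN (x n) q]
      have h2 : ‖x n - q‖ ≤ C + ‖q‖ := (norm_sub_le _ _).trans (by linarith [hC n])
      have h3 : ‖x n - N q‖ ^ 2 = ‖x n - q‖ ^ 2 + 2 * ⟪x n - q, q - N q⟫_ℝ + ‖q - N q‖ ^ 2 := by
        rw [← norm_add_sq_real]; congr 2; abel
      rw [inner_sub_left] at h3
      have h4 := pow_le_pow_left₀ (norm_nonneg _) h1 2
      nlinarith [norm_nonneg (x (n + 1) - x n)]
    have hl : Tendsto (fun n => ‖q - N q‖ ^ 2 + 2 * (⟪x n, q - N q⟫_ℝ - ⟪q, q - N q⟫_ℝ)) 𝒰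
        (𝓝 (‖q - N q‖ ^ 2 + 2 * (⟪q, q - N q⟫_ℝ - ⟪q, q - N q⟫_ℝ))) :=
      (((hq _).sub_const _).const_mul 2).const_add _
    have hr : Tendsto (fun n => ‖x (n + 1) - x n‖ ^ 2 + 2 * (C + ‖q‖) * ‖x (n + 1) - x n‖) 𝒰
        (𝓝 (0 ^ 2 + 2 * (C + ‖q‖) * 0)) := (hε.pow 2).add (hε.const_mul _)
    have h := le_of_tendsto_of_tendsto' hl hr key
    have h0 : ‖q - N q‖ = 0 := by
      rw [← sq_eq_zero_iff]
      exact le_antisymm (by simpa using h) (sq_nonneg _)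
    exact (sub_eq_zero.1 (norm_eq_zero.1 h0)).symm
  -- The distance to a fixed point decreases along the orbit, hence converges.
  have fejer : ∀ q, N q = q → ∃ d, Tendsto (fun n => ‖x n - q‖ ^ 2) atTop (𝓝 d) := by
    intro q hq
    have hanti : Antitone fun n => ‖x n - q‖ := antitone_nat_of_succ_le fun n => by
      have := hN (x n) q
      rwa [hq, ← hx] at this
    exact ⟨_, (tendsto_atTop_ciInf hanti ⟨0, by rintro _ ⟨n, rfl⟩; exact norm_nonneg _⟩).pow 2⟩
  obtain ⟨q, hq⟩ := exists_weak_limit_of_ultrafilter hC (Ultrafilter.of atTop)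
  have hqN := demi _ (Ultrafilter.of_le atTop) q hq
  refine ⟨q, hqN, fun y => (tendsto_iff_ultrafilter _ _ _).2 fun 𝒰 h𝒰 => ?_⟩
  obtain ⟨q', hq'⟩ := exists_weak_limit_of_ultrafilter hC 𝒰
  have hqN' := demi 𝒰 h𝒰 q' hq'
  obtain ⟨d, hd⟩ := fejer q hqN
  obtain ⟨d', hd'⟩ := fejer q' hqN'
  -- `⟪x n, q' - q⟫` is an affine function of the difference of the two squared distances.
  have hconv : Tendsto (fun n => ⟪x n, q' - q⟫_ℝ) atTop
      (𝓝 ((d - d' - (‖q‖ ^ 2 - ‖q'‖ ^ 2)) / 2)) := by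
    refine (((hd.sub hd').sub_const _).div_const 2).congr fun n => ?_
    rw [norm_sub_sq_real, norm_sub_sq_real, inner_sub_right]; ring
  -- Both weak cluster points therefore have the same inner product with `q' - q`.
  have e1 := tendsto_nhds_unique (hconv.mono_left (Ultrafilter.of_le atTop)) (hq (q' - q))
  have e2 := tendsto_nhds_unique (hconv.mono_left h𝒰) (hq' (q' - q))
  have hqq : q' = q := by
    have : ⟪q' - q, q' - q⟫_ℝ = 0 := by rw [inner_sub_left]; linarith
    exact sub_eq_zero.1 (inner_self_eq_zero.1 this)
  exact hqq ▸ hq' y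

/-- A gradient iteration is bounded as soon as its image under `T` is bounded and its component
orthogonal to a finite-dimensional space `K`, on which no proximal map acts, is bounded: the
increments inside `K` lie in the range of `P T*`, on which `T` is bounded below. -/
theorem exists_norm_le_of_finiteDimensional (T : E →L[ℝ] E') (g : E') (K : Submodule ℝ E)
    [FiniteDimensional ℝ K] {x : ℕ → E}
    (hx : ∀ n, K.starProjection (x (n + 1)) =
      K.starProjection (x n + ContinuousLinearMap.adjoint T (g - T (x n))))
    {A B : ℝ} (hA : ∀ n, ‖T (x n)‖ ≤ A) (hB : ∀ n, ‖x n - K.starProjection (x n)‖ ≤ B) :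
    ∃ C, ∀ n, ‖x n‖ ≤ C := by
  set P := K.starProjection with hP
  let R : Submodule ℝ E := LinearMap.range
    ((P : E →ₗ[ℝ] E).comp (ContinuousLinearMap.adjoint T : E' →ₗ[ℝ] E))
  have hRK : R ≤ K := by
    rintro _ ⟨y, rfl⟩
    exact K.starProjection_apply_mem _
  have : FiniteDimensional ℝ R := Submodule.finiteDimensional_of_le hRK
  have hker : LinearMap.ker ((T : E →ₗ[ℝ] E').comp R.subtype) = ⊥ := by
    refine LinearMap.ker_eq_bot'.2 ?_
    rintro ⟨z, hz⟩ hTz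
    have hTz : T z = 0 := hTz
    obtain ⟨y, hy⟩ := id hz
    have hy : P (ContinuousLinearMap.adjoint T y) = z := hy
    have hPz : P z = z := Submodule.starProjection_eq_self_iff.2 (hRK hz)
    have : ⟪z, z⟫_ℝ = 0 := by
      calc ⟪z, z⟫_ℝ = ⟪P (ContinuousLinearMap.adjoint T y), z⟫_ℝ := by rw [hy]
        _ = ⟪ContinuousLinearMap.adjoint T y, P z⟫_ℝ :=
          Submodule.inner_starProjection_left_eq_right K _ _
        _ = 0 := by rw [hPz, ContinuousLinearMap.adjoint_inner_left, hTz, inner_zero_right]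
    exact Subtype.ext (inner_self_eq_zero.1 this)
  obtain ⟨L, -, hL⟩ := LinearMap.exists_antilipschitzWith _ hker
  have hbelow : ∀ z ∈ R, ‖z‖ ≤ L * ‖T z‖ := fun z hz =>
    ZeroHomClass.bound_of_antilipschitz ((T : E →ₗ[ℝ] E').comp R.subtype) hL ⟨z, hz⟩
  have hmem : ∀ n, P (x n) - P (x 0) ∈ R := by
    intro n
    induction n with
    | zero => simp
    | succ n ih =>
      have h1 : P (x (n + 1)) - P (x 0) = (P (x n) - P (x 0)) +
          P (ContinuousLinearMap.adjoint T (g - T (x n))) := by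
        rw [hx, map_add]; abel
      rw [h1]
      exact R.add_mem ih ⟨_, rfl⟩
  have hTP : ∀ n, ‖T (P (x n))‖ ≤ A + ‖T‖ * B := fun n => by
    have h1 : T (P (x n)) = T (x n) - T (x n - P (x n)) := by rw [map_sub]; abel
    rw [h1]
    refine (norm_sub_le _ _).trans (add_le_add (hA n) ?_)
    exact (T.le_opNorm _).trans (mul_le_mul_of_nonneg_left (hB n) (norm_nonneg _))
  refine ⟨B + ‖P (x 0)‖ + L * (2 * (A + ‖T‖ * B)), fun n => ?_⟩
  have h1 := hbelow _ (hmem n)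
  have h2 : ‖T (P (x n) - P (x 0))‖ ≤ 2 * (A + ‖T‖ * B) := by
    rw [map_sub]
    exact (norm_sub_le _ _).trans (by linarith [hTP n, hTP 0])
  have h3 := mul_le_mul_of_nonneg_left h2 L.coe_nonneg
  calc ‖x n‖ = ‖(x n - P (x n)) + P (x 0) + (P (x n) - P (x 0))‖ := by congr 1; abel
    _ ≤ ‖x n - P (x n)‖ + ‖P (x 0)‖ + ‖P (x n) - P (x 0)‖ := norm_add₃_le
    _ ≤ _ := by linarith [hB n]

/-- For `‖T‖ ≤ 1` the gradient step of `‖T x - g‖ ^ 2 / 2` is nonexpansive. -/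
theorem norm_add_adjoint_sub_le {T : E →L[ℝ] E'} (hT : ‖T‖ ≤ 1) (g : E') (x y : E) :
    ‖(x + ContinuousLinearMap.adjoint T (g - T x)) - (y + ContinuousLinearMap.adjoint T (g - T y))‖
      ≤ ‖x - y‖ := by
  have h1 : (x + ContinuousLinearMap.adjoint T (g - T x)) -
      (y + ContinuousLinearMap.adjoint T (g - T y)) =
      (x - y) - ContinuousLinearMap.adjoint T (T (x - y)) := by
    simp only [map_sub]; abel
  rw [h1, ← sq_le_sq₀ (norm_nonneg _) (norm_nonneg _), norm_sub_sq_real,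
    ContinuousLinearMap.adjoint_inner_right, real_inner_self_eq_norm_sq]
  have h2 : ‖ContinuousLinearMap.adjoint T (T (x - y))‖ ≤ ‖T (x - y)‖ := by
    refine (ContinuousLinearMap.le_opNorm _ _).trans ?_
    rw [LinearIsometryEquiv.norm_map]
    exact mul_le_of_le_one_left (norm_nonneg _) hT
  have := pow_le_pow_left₀ (norm_nonneg _) h2 2
  linarith [sq_nonneg ‖T (x - y)‖]

end Hilbert

/-! ### The scalar thresholding functions -/

/-- The proximal map of `t ↦ |t| ^ p`: the minimizer of `t ↦ (t - l) ^ 2 + |t| ^ p`, which is soft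
thresholding for `p = 1` and the inverse of `F p` for `p > 1`. -/
def prox (p l : ℝ) : ℝ :=
  if p = 1 then (if |l| ≤ 1 / 2 then 0 else (|l| - 1 / 2) * Real.sign l) else Finv p l

theorem prox_of_one_lt {p : ℝ} (hp : 1 < p) (l : ℝ) : prox p l = Finv p l :=
  if_neg hp.ne'

theorem prox_one (l : ℝ) :
    (|l| ≤ 1 / 2 ∧ prox 1 l = 0) ∨ (1 / 2 < l ∧ prox 1 l = l - 1 / 2) ∨
      (l < -(1 / 2) ∧ prox 1 l = l + 1 / 2) := by
  unfold prox
  rw [if_pos rfl]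
  split_ifs with h
  · exact Or.inl ⟨h, rfl⟩
  · rcases lt_abs.1 (not_le.1 h) with h' | h'
    · right; left
      rw [Real.sign_of_pos (by linarith), abs_of_pos (by linarith)]
      exact ⟨h', by ring⟩
    · right; right
      rw [Real.sign_of_neg (by linarith), abs_of_neg (by linarith)]
      exact ⟨by linarith, by ring⟩

/-- The tangent line of `|·| ^ p` at `s` lies below the graph. -/
theorem rpow_abs_add_le {p : ℝ} (hp : 1 < p) (s t : ℝ) :
    |s| ^ p + p * Real.sign s * |s| ^ (p - 1) * (t - s) ≤ |t| ^ p := by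
  have hq := Real.HolderConjugate.conjExponent hp
  have hy := Real.young_inequality_of_nonneg (abs_nonneg t)
    (Real.rpow_nonneg (abs_nonneg s) (p - 1)) hq
  have e1 : (|s| ^ (p - 1)) ^ p.conjExponent = |s| ^ p := by
    rw [← Real.rpow_mul (abs_nonneg s)]
    congr 1
    unfold Real.conjExponent
    field_simp [(sub_pos.2 hp).ne']
  have e2 : p.conjExponent⁻¹ = 1 - p⁻¹ := by linarith [hq.inv_add_inv_eq_one]
  rw [e1, div_eq_mul_inv, div_eq_mul_inv, e2] at hy
  have hp0 : 0 < p := by linarith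
  have hy2 : p * (|t| * |s| ^ (p - 1)) ≤ |t| ^ p + (p - 1) * |s| ^ p := by
    have := mul_le_mul_of_nonneg_left hy hp0.le
    have e : p * (|t| ^ p * p⁻¹ + |s| ^ p * (1 - p⁻¹)) = |t| ^ p + (p - 1) * |s| ^ p := by
      field_simp
    linarith
  have e3 : Real.sign s * |s| ^ (p - 1) * s = |s| ^ p := by
    have hss : Real.sign s * s = |s| := by
      rcases lt_trichotomy s 0 with h | h | h
      · rw [Real.sign_of_neg h, abs_of_neg h]; ring
      · simp [h]
      · rw [Real.sign_of_pos h, abs_of_pos h]; ring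
    rcases eq_or_ne s 0 with rfl | hs
    · simp [hp0.ne']
    · rw [mul_right_comm, hss, mul_comm, ← Real.rpow_add_one (abs_pos.2 hs).ne', sub_add_cancel]
  have e4 : Real.sign s * t ≤ |t| := by
    rcases Real.sign_apply_eq s with h | h | h <;> rw [h]
    · linarith [neg_le_abs t]
    · simp
    · linarith [le_abs_self t]
  have e5 := mul_le_mul_of_nonneg_left e4 (mul_nonneg hp0.le (Real.rpow_nonneg (abs_nonneg s) (p - 1)))
  nlinarith

/-- `prox p l` minimizes the strongly convex function `t ↦ (t - l) ^ 2 + |t| ^ p`. -/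
theorem prox_strong_min {p : ℝ} (hp : 1 ≤ p) (l t : ℝ) :
    (prox p l - l) ^ 2 + |prox p l| ^ p + (t - prox p l) ^ 2 ≤ (t - l) ^ 2 + |t| ^ p := by
  rcases hp.eq_or_lt with rfl | hp
  · simp only [Real.rpow_one]
    rcases prox_one l with ⟨h, e⟩ | ⟨h, e⟩ | ⟨h, e⟩ <;> rw [e]
    · have : t * l ≤ |t| * (1 / 2) := by
        calc t * l ≤ |t * l| := le_abs_self _
          _ = |t| * |l| := abs_mul _ _
          _ ≤ _ := mul_le_mul_of_nonneg_left h (abs_nonneg _)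
      simp only [abs_zero]; nlinarith
    · rw [abs_of_pos (by linarith : 0 < l - 1 / 2)]; nlinarith [le_abs_self t]
    · rw [abs_of_neg (by linarith : l + 1 / 2 < 0)]; nlinarith [neg_le_abs t]
  · rw [prox_of_one_lt hp]
    have h1 := F_Finv hp l
    have h2 := rpow_abs_add_le hp (Finv p l) t
    generalize Finv p l = s at *
    unfold F at h1
    rw [← h1]
    nlinarith

/-- Adding the strong minimality inequalities at `l` and at `m`, each tested with the other
minimizer, shows that `prox p` is nonexpansive; in the same way it is monotone. -/
theorem abs_prox_sub_le {p : ℝ} (hp : 1 ≤ p) (l m : ℝ) : |prox p l - prox p m| ≤ |l - m| := by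
  have h1 := prox_strong_min hp l (prox p m)
  have h2 := prox_strong_min hp m (prox p l)
  rw [← sq_le_sq]
  nlinarith [sq_nonneg ((l - m) - (prox p l - prox p m))]

theorem prox_mono {p : ℝ} (hp : 1 ≤ p) : Monotone (prox p) := by
  intro l m h
  have h1 := prox_strong_min hp l (prox p m)
  have h2 := prox_strong_min hp m (prox p l)
  by_contra! h3
  nlinarith [mul_nonneg (sub_nonneg.2 h) (sub_pos.2 h3).le, mul_pos (sub_pos.2 h3) (sub_pos.2 h3)]

theorem prox_zero {p : ℝ} (hp : 1 ≤ p) : prox p 0 = 0 := by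
  have h := prox_strong_min hp 0 0
  have h1 := Real.rpow_nonneg (abs_nonneg (prox p 0)) p
  have h0 : |(0 : ℝ)| ^ p = 0 := by rw [abs_zero, Real.zero_rpow (by linarith)]
  nlinarith

theorem prox_neg {p : ℝ} (hp : 1 ≤ p) (l : ℝ) : prox p (-l) = -prox p l := by
  have h1 := prox_strong_min hp l (-prox p (-l))
  have h2 := prox_strong_min hp (-l) (-prox p l)
  rw [abs_neg] at h1 h2
  nlinarith [sq_nonneg (prox p (-l) + prox p l)]

theorem abs_prox_le {p : ℝ} (hp : 1 ≤ p) (l : ℝ) : |prox p l| ≤ |l| := by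
  simpa [prox_zero hp] using abs_prox_sub_le hp l 0

theorem abs_prox_le_prox {p l m : ℝ} (hp : 1 ≤ p) (h : |l| ≤ m) : |prox p l| ≤ prox p m := by
  rw [abs_le] at h ⊢
  rw [← prox_neg hp]
  exact ⟨prox_mono hp h.1, prox_mono hp h.2⟩

theorem prox_lt_self {p l : ℝ} (hp : 1 ≤ p) (hl : 0 < l) : prox p l < l := by
  rcases hp.eq_or_lt with rfl | hp'
  · rcases prox_one l with ⟨h, e⟩ | ⟨h, e⟩ | ⟨h, e⟩ <;> rw [e] <;> linarith
  · rw [prox_of_one_lt hp', ← (F_strictMono hp').lt_iff_lt, F_Finv hp', F_of_nonneg hp' hl.le]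
    have : 0 < p / 2 * l ^ (p - 1) := mul_pos (by linarith) (Real.rpow_pos_of_pos hl _)
    linarith

theorem jump_one_of_quarter_le {r : ℝ} (hr : 1 / 4 ≤ r) : jump 1 r = r + 1 / 4 := by
  unfold jump
  rw [if_pos rfl]
  split_ifs with h
  · rfl
  · have : r = (1 / 2) ^ 2 := by linarith
    rw [this, Real.sqrt_sq (by norm_num)]; norm_num

/-- The jump sits where the minimal value of `(t - l) ^ 2 + |t| ^ p` reaches `r ^ p`. -/
theorem jump_spec {p r : ℝ} (hp : 1 ≤ p) (hr : 0 < r) :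
    0 < jump p r ∧ (prox p (jump p r) - jump p r) ^ 2 + |prox p (jump p r)| ^ p = r ^ p := by
  rcases hp.eq_or_lt with rfl | hp
  · simp only [Real.rpow_one]
    by_cases h : 1 / 4 < r
    · rw [jump_one_of_quarter_le h.le]
      refine ⟨by linarith, ?_⟩
      rcases prox_one (r + 1 / 4) with ⟨h', e⟩ | ⟨h', e⟩ | ⟨h', e⟩
      · linarith [le_abs_self (r + 1 / 4)]
      · rw [e, abs_of_pos (by linarith)]; ring
      · linarith
    · have hj : jump 1 r = Real.sqrt r := by simp only [jump, if_true, if_neg h]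
      have hs := Real.sq_sqrt hr.le
      have hs0 := Real.sqrt_pos.2 hr
      have hs1 : Real.sqrt r ≤ 1 / 2 := by nlinarith
      rw [hj]
      refine ⟨hs0, ?_⟩
      rcases prox_one (Real.sqrt r) with ⟨h', e⟩ | ⟨h', e⟩ | ⟨h', e⟩
      · rw [e, abs_zero]; linarith
      · linarith
      · linarith
  · rw [prox_of_one_lt hp]
    exact isJump_jump hp hr

/-- Below the jump `H` is the proximal map, also for `p = 1` and `r ≤ 1 / 4`, where the jump does
not exceed `1 / 2` and soft thresholding vanishes there. -/
theorem H_eq {p r : ℝ} (hr : 0 < r) (l : ℝ) :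
    H p r l = if |l| ≤ jump p r then prox p l else l := by
  rcases eq_or_ne p 1 with rfl | hp
  · unfold H
    rw [if_pos rfl]
    split_ifs with h1 h2 h3 h4 h5
    · simp only [prox, if_true, if_pos h2]
    · rw [jump_one_of_quarter_le h1.le] at h3; linarith
    · simp only [prox, if_true, if_neg h2]
    · rfl
    · have hj : jump 1 r = Real.sqrt r := by simp only [jump, if_true, if_neg h1]
      have hs := Real.sq_sqrt hr.le
      have hs0 := Real.sqrt_pos.2 hr
      have : |l| ≤ 1 / 2 := by rw [hj] at h5; nlinarith
      simp only [prox, this, if_true]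
    · rfl
  · simp [H, prox, hp]

/-- Testing the minimality of `prox p` at the jump with the jump itself gives
`r ^ p < jump p r ^ p`. -/
theorem lt_jump {p r : ℝ} (hp : 1 ≤ p) (hr : 0 < r) : r < jump p r := by
  obtain ⟨h0, h⟩ := jump_spec hp hr
  have h1 := prox_strong_min hp (jump p r) (jump p r)
  have h2 := prox_lt_self hp h0
  have h3 : r ^ p < jump p r ^ p := by
    rw [h, abs_of_pos h0] at h1
    nlinarith [mul_pos (sub_pos.2 h2) (sub_pos.2 h2)]
  exact (Real.rpow_lt_rpow_iff hr.le h0.le (by linarith)).1 h3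

/-- The minimal value of `(t - l) ^ 2 + |t| ^ p` is nondecreasing in `|l|`, as scaling by `c` with
`|c| ≤ 1` shows. -/
theorem prox_value_mono {p : ℝ} (hp : 1 ≤ p) {l m : ℝ} (h : |l| ≤ |m|) :
    (prox p l - l) ^ 2 + |prox p l| ^ p ≤ (prox p m - m) ^ 2 + |prox p m| ^ p := by
  obtain ⟨c, hc, rfl⟩ : ∃ c : ℝ, |c| ≤ 1 ∧ l = c * m := by
    rcases eq_or_ne m 0 with rfl | hm
    · exact ⟨0, by simp, by simpa using h⟩
    · exact ⟨l / m, by rw [abs_div]; exact div_le_one_of_le₀ h (abs_nonneg _), by field_simp⟩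
  have h1 := prox_strong_min hp (c * m) (c * prox p m)
  have h2 : |c * prox p m| ^ p ≤ |prox p m| ^ p := by
    refine Real.rpow_le_rpow (abs_nonneg _) ?_ (by linarith)
    rw [abs_mul]; exact mul_le_of_le_one_left (abs_nonneg _) hc
  have h3 : c ^ 2 ≤ 1 := by rw [← sq_abs]; nlinarith [abs_nonneg c]
  nlinarith [sq_nonneg (c * prox p m - prox p (c * m)),
    mul_le_mul_of_nonneg_right h3 (sq_nonneg (prox p m - m))]

theorem abs_prox_le_radius {p r l : ℝ} (hp : 1 ≤ p) (hr : 0 < r) (hl : |l| ≤ jump p r) :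
    |prox p l| ≤ r := by
  obtain ⟨h0, h⟩ := jump_spec hp hr
  have h1 := prox_value_mono hp (hl.trans (le_abs_self _))
  have h2 : |prox p l| ^ p ≤ r ^ p := by linarith [sq_nonneg (prox p l - l)]
  exact (Real.rpow_le_rpow_iff (abs_nonneg _) hr.le (by linarith)).1 h2

/-- `H p r l` minimizes the truncated function `t ↦ (t - l) ^ 2 + min (|t| ^ p) (r ^ p)`. -/
theorem H_min {p r : ℝ} (hp : 1 ≤ p) (hr : 0 < r) (l t : ℝ) :
    (H p r l - l) ^ 2 + min (|H p r l| ^ p) (r ^ p) ≤ (t - l) ^ 2 + min (|t| ^ p) (r ^ p) := by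
  obtain ⟨h0, h⟩ := jump_spec hp hr
  have hs := prox_strong_min hp l t
  have ht := sq_nonneg (t - l)
  have hs' := sq_nonneg (t - prox p l)
  -- With `m l` for the minimal value without truncation, `H` chooses `prox p l` where
  -- `m l ≤ r ^ p` and `l` itself, at cost at most `r ^ p`, where `r ^ p ≤ m l`.
  rw [H_eq hr]
  split_ifs with hl
  · have h1 := prox_value_mono hp (hl.trans (le_abs_self _))
    have h2 := min_le_left (|prox p l| ^ p) (r ^ p)
    rcases min_choice (|t| ^ p) (r ^ p) with e | e <;> rw [e] <;> linarith
  · have h1 := prox_value_mono hp (l := jump p r) (m := l) (by rw [abs_of_pos h0]; linarith)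
    have h2 := min_le_right (|l| ^ p) (r ^ p)
    rw [sub_self]
    rcases min_choice (|t| ^ p) (r ^ p) with e | e <;> rw [e] <;> linarith

/-! ### Components and coordinate subspaces of `ℓ₂` -/

variable {ι κ : Type*}

theorem L2.hasSum_sq (x : L2 ι) : HasSum (fun i => x i ^ 2) (‖x‖ ^ 2) := by
  have h := lp.hasSum_inner (𝕜 := ℝ) x x
  rw [real_inner_self_eq_norm_sq] at h
  simpa [sq] using h

theorem L2.abs_apply_le (x : L2 ι) (i : ι) : |x i| ≤ ‖x‖ :=
  lp.norm_apply_le_norm (by norm_num) x i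

open Classical in
theorem L2.inner_single_one (x : L2 ι) (i : ι) :
    ⟪(lp.single 2 i (1 : ℝ) : L2 ι), x⟫_ℝ = x i := by
  rw [lp.inner_single_left]; simp

theorem L2.finite_lt_abs (x : L2 ι) {c : ℝ} (hc : 0 < c) : {i | c < |x i|}.Finite := by
  have h := (L2.hasSum_sq x).summable.tendsto_cofinite_zero
  have h2 := h.eventually (gt_mem_nhds (pow_pos hc 2))
  refine (Filter.eventually_cofinite.1 h2).subset fun i hi => ?_
  have hi : c < |x i| := hi
  simp only [Set.mem_ofPred_eq, not_lt]
  rw [← sq_abs (x i)]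
  exact pow_le_pow_left₀ hc.le hi.le 2

open Classical in
/-- The span of the unit vectors with index in `s`; for finite `s`, the families supported in `s`. -/
def coordSpan (s : Set ι) : Submodule ℝ (L2 ι) :=
  Submodule.span ℝ ((fun i => (lp.single 2 i (1 : ℝ) : L2 ι)) '' s)

theorem finiteDimensional_coordSpan {s : Set ι} (hs : s.Finite) :
    FiniteDimensional ℝ (coordSpan s) :=
  FiniteDimensional.span_of_finite ℝ (hs.image _)

theorem starProjection_coordSpan_of_mem {s : Set ι} [(coordSpan s).HasOrthogonalProjection]
    (x : L2 ι) {i : ι} (hi : i ∈ s) : (coordSpan s).starProjection x i = x i := by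
  classical
  rw [← L2.inner_single_one, ← Submodule.inner_starProjection_left_eq_right,
    Submodule.starProjection_eq_self_iff.2, L2.inner_single_one]
  exact Submodule.subset_span ⟨i, hi, by congr⟩

theorem starProjection_coordSpan_of_notMem {s : Set ι} [(coordSpan s).HasOrthogonalProjection]
    (x : L2 ι) {i : ι} (hi : i ∉ s) : (coordSpan s).starProjection x i = 0 := by
  classical
  have h : (lp.single 2 i (1 : ℝ) : L2 ι) ∈ (coordSpan s)ᗮ := by
    unfold coordSpan
    rw [Submodule.mem_orthogonal]
    intro y hy
    induction hy using Submodule.span_induction with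
    | mem y hy =>
      obtain ⟨j, hj, rfl⟩ := hy
      have hij : j ≠ i := fun h => hi (h ▸ hj)
      rw [real_inner_comm, L2.inner_single_one]
      exact lp.single_apply_ne _ _ _ hij.symm
    | zero => exact inner_zero_left _
    | add y z _ _ hy hz => rw [inner_add_left, hy, hz, add_zero]
    | smul c y _ hy => rw [real_inner_smul_left, hy, mul_zero]
  rw [← L2.inner_single_one]
  exact Submodule.inner_left_of_mem_orthogonal (Submodule.starProjection_apply_mem _ _) h

/-! ### The energy along the iteration -/

variable {p r : ℝ} (T : L2 ι →L[ℝ] L2 κ) (g : L2 κ)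

/-- The gradient step `u + T*(g - T u)`. -/
def gradStep (u : L2 ι) : L2 ι := u + corr T g u

theorem gradStep_apply (u : L2 ι) (i : ι) : gradStep T g u i = u i + corr T g u i := rfl

theorem thresholdMap_apply (hp : 1 ≤ p) (u : L2 ι) (i : ι) :
    thresholdMap p r hp T g u i = H p r (gradStep T g u i) := by
  have : u - ContinuousLinearMap.adjoint T (T u) + ContinuousLinearMap.adjoint T g
      = gradStep T g u := by
    simp only [gradStep, corr, map_sub]; abel
  rw [← this]; rfl

theorem norm_gradStep_sub_le {T : L2 ι →L[ℝ] L2 κ} (hT : ‖T‖ ≤ 1) (u v : L2 ι) :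
    ‖gradStep T g u - gradStep T g v‖ ≤ ‖u - v‖ :=
  norm_add_adjoint_sub_le hT g u v

/-- The real-valued penalty of one component. -/
def penalty (p r t : ℝ) : ℝ := min (|t| ^ p) (r ^ p)

theorem penalty_nonneg (hr : 0 < r) (t : ℝ) : 0 ≤ penalty p r t :=
  le_min (Real.rpow_nonneg (abs_nonneg _) _) (Real.rpow_nonneg hr.le _)

/-- The functional `J` as a real number; it is meaningful where the penalties are summable. -/
def energy (p r : ℝ) (T : L2 ι →L[ℝ] L2 κ) (g : L2 κ) (u : L2 ι) : ℝ :=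
  ‖T u - g‖ ^ 2 + ∑' i, penalty p r (u i)

theorem summable_penalty_of_J_lt_top (hr : 0 < r) {u : L2 ι} (h : J p r T g u < ∞) :
    Summable fun i => penalty p r (u i) := by
  have h1 : (∑' i, ENNReal.ofReal (penalty p r (u i))) ≠ ∞ :=
    ((le_add_self).trans_lt h).ne
  have h2 := ENNReal.summable_toReal h1
  simpa only [ENNReal.toReal_ofReal (penalty_nonneg hr _)] using h2

/-- Each step decreases the energy by at least a multiple of the squared step length: componentwise,
`H` minimizes the surrogate functional `J(v) + ‖v - u‖ ^ 2 - ‖T (v - u)‖ ^ 2`. -/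
theorem energy_thresholdMap_le (hp : 1 ≤ p) (hr : 0 < r) {u : L2 ι}
    (hu : Summable fun i => penalty p r (u i)) :
    (Summable fun i => penalty p r (thresholdMap p r hp T g u i)) ∧
    energy p r T g (thresholdMap p r hp T g u) +
      (1 - ‖T‖ ^ 2) * ‖thresholdMap p r hp T g u - u‖ ^ 2 ≤ energy p r T g u := by
  set v := thresholdMap p r hp T g u with hv
  set a := gradStep T g u with ha
  have hmin : ∀ i, (v - a) i ^ 2 + penalty p r (v i) ≤ (u - a) i ^ 2 + penalty p r (u i) := by
    intro i
    have h := H_min hp hr (a i) (u i)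
    rwa [ha, ← thresholdMap_apply T g hp] at h
  have hsu : Summable fun i => (u - a) i ^ 2 + penalty p r (u i) :=
    (L2.hasSum_sq (u - a)).summable.add hu
  have hsv : Summable fun i => penalty p r (v i) :=
    hsu.of_nonneg_of_le (fun i => penalty_nonneg hr _)
      fun i => (le_add_of_nonneg_left (sq_nonneg _)).trans (hmin i)
  refine ⟨hsv, ?_⟩
  have hsum : ‖v - a‖ ^ 2 + ∑' i, penalty p r (v i) ≤ ‖u - a‖ ^ 2 + ∑' i, penalty p r (u i) :=
    hasSum_le hmin ((L2.hasSum_sq (v - a)).add hsv.hasSum) ((L2.hasSum_sq (u - a)).add hu.hasSum)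
  have e1 : ‖v - a‖ ^ 2 = ‖v - u‖ ^ 2 - 2 * ⟪T (v - u), g - T u⟫_ℝ + ‖u - a‖ ^ 2 := by
    have h1 : v - a = (v - u) - corr T g u := by rw [ha, gradStep]; abel
    have h2 : u - a = -corr T g u := by rw [ha, gradStep]; abel
    rw [h1, h2, norm_neg, norm_sub_sq_real, corr, ContinuousLinearMap.adjoint_inner_right]
  have e2 : ‖T v - g‖ ^ 2 = ‖T (v - u)‖ ^ 2 - 2 * ⟪T (v - u), g - T u⟫_ℝ + ‖T u - g‖ ^ 2 := by
    have h1 : T v - g = T (v - u) - (g - T u) := by rw [map_sub]; abel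
    rw [h1, norm_sub_sq_real, norm_sub_rev g]
  have e3 := pow_le_pow_left₀ (norm_nonneg _) (T.le_opNorm (v - u)) 2
  rw [mul_pow] at e3
  unfold energy
  linarith

theorem tsum_penalty_nonneg (hr : 0 < r) (u : L2 ι) : 0 ≤ ∑' i, penalty p r (u i) :=
  tsum_nonneg fun _ => penalty_nonneg hr _

theorem summable_penalty_iterate (hp : 1 ≤ p) (hr : 0 < r) {x : ℕ → L2 ι}
    (hx : ∀ n, x (n + 1) = thresholdMap p r hp T g (x n))
    (h0 : Summable fun i => penalty p r (x 0 i)) (n : ℕ) :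
    Summable fun i => penalty p r (x n i) := by
  induction n with
  | zero => exact h0
  | succ n ih =>
    rw [hx]
    exact (energy_thresholdMap_le T g hp hr ih).1

theorem energy_iterate_succ_le (hp : 1 ≤ p) (hr : 0 < r) {x : ℕ → L2 ι}
    (hx : ∀ n, x (n + 1) = thresholdMap p r hp T g (x n))
    (h0 : Summable fun i => penalty p r (x 0 i)) (n : ℕ) :
    energy p r T g (x (n + 1)) + (1 - ‖T‖ ^ 2) * ‖x (n + 1) - x n‖ ^ 2 ≤ energy p r T g (x n) := by
  rw [hx]
  exact (energy_thresholdMap_le T g hp hr (summable_penalty_iterate T g hp hr hx h0 n)).2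

theorem antitone_energy_iterate {T : L2 ι →L[ℝ] L2 κ} (hT : ‖T‖ < 1) (hp : 1 ≤ p) (hr : 0 < r)
    {x : ℕ → L2 ι} (hx : ∀ n, x (n + 1) = thresholdMap p r hp T g (x n))
    (h0 : Summable fun i => penalty p r (x 0 i)) :
    Antitone fun n => energy p r T g (x n) := by
  refine antitone_nat_of_succ_le fun n => ?_
  have h := energy_iterate_succ_le T g hp hr hx h0 n
  have h1 : ‖T‖ ^ 2 ≤ 1 := pow_le_one₀ (norm_nonneg _) hT.le
  linarith [mul_nonneg (sub_nonneg.2 h1) (sq_nonneg ‖x (n + 1) - x n‖)]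

/-- The iteration is asymptotically regular. -/
theorem tendsto_norm_iterate_sub {T : L2 ι →L[ℝ] L2 κ} (hT : ‖T‖ < 1) (hp : 1 ≤ p) (hr : 0 < r)
    {x : ℕ → L2 ι} (hx : ∀ n, x (n + 1) = thresholdMap p r hp T g (x n))
    (h0 : Summable fun i => penalty p r (x 0 i)) :
    Tendsto (fun n => ‖x (n + 1) - x n‖) atTop (𝓝 0) := by
  have hlim := tendsto_atTop_ciInf (antitone_energy_iterate g hT hp hr hx h0)
    ⟨0, by rintro _ ⟨n, rfl⟩; exact add_nonneg (sq_nonneg _) (tsum_penalty_nonneg hr _)⟩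
  have hdiff := (hlim.sub (hlim.comp (tendsto_add_atTop_nat 1))).div_const (1 - ‖T‖ ^ 2)
  rw [sub_self, zero_div] at hdiff
  have hc : 0 < 1 - ‖T‖ ^ 2 := sub_pos.2 (pow_lt_one₀ (norm_nonneg _) hT two_ne_zero)
  have hsq : Tendsto (fun n => ‖x (n + 1) - x n‖ ^ 2) atTop (𝓝 0) := by
    refine squeeze_zero (fun n => sq_nonneg _) (fun n => ?_) hdiff
    rw [le_div_iff₀ hc]
    have h := energy_iterate_succ_le T g hp hr hx h0 n
    simp only [Function.comp_apply]
    linarith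
  simpa [Real.sqrt_sq (norm_nonneg _)] using hsq.sqrt

/-- Where `p ≤ 2` or the index set is finite, the penalty controls the `ℓ₂` norm of the components
of modulus at most `r`. -/
theorem exists_norm_le_of_penalty_le (hp2 : p ≤ 2 ∨ Finite ι) (hp : 1 ≤ p) (hr : 0 < r) (M : ℝ) :
    ∃ B, ∀ u w : L2 ι, (Summable fun i => penalty p r (u i)) → ∑' i, penalty p r (u i) ≤ M →
      (∀ i, w i = 0 ∨ (w i = u i ∧ |u i| ≤ r)) → ‖w‖ ≤ B := by
  rcases hp2 with hp2 | hfin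
  · -- For `|t| ≤ r` one has `t ^ 2 = |t| ^ (2 - p) * |t| ^ p ≤ r ^ (2 - p) * |t| ^ p`.
    refine ⟨Real.sqrt (r ^ (2 - p) * M), fun u w hu hM hw => Real.le_sqrt_of_sq_le ?_⟩
    have hc : 0 ≤ r ^ (2 - p) := Real.rpow_nonneg hr.le _
    refine (hasSum_le (fun i => ?_) (L2.hasSum_sq w) (hu.hasSum.mul_left (r ^ (2 - p)))).trans
      (mul_le_mul_of_nonneg_left hM hc)
    rcases hw i with h | ⟨h, hle⟩
    · rw [h, zero_pow two_ne_zero]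
      exact mul_nonneg hc (penalty_nonneg hr _)
    · rw [h, penalty, min_eq_left (Real.rpow_le_rpow (abs_nonneg _) hle (by linarith))]
      rcases (abs_nonneg (u i)).eq_or_lt with h0 | h0
      · rw [← sq_abs, ← h0, Real.zero_rpow (by linarith)]; simp
      · have e : u i ^ 2 = |u i| ^ (2 - p) * |u i| ^ p := by
          rw [← Real.rpow_add h0, sub_add_cancel, Real.rpow_two, sq_abs]
        rw [e]
        exact mul_le_mul_of_nonneg_right
          (Real.rpow_le_rpow h0.le hle (by linarith)) (Real.rpow_nonneg h0.le _)
  · have := Fintype.ofFinite ι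
    refine ⟨Real.sqrt (∑ _i : ι, r ^ 2), fun u w _ _ hw => Real.le_sqrt_of_sq_le ?_⟩
    refine hasSum_le (fun i => ?_) (L2.hasSum_sq w) (hasSum_fintype fun _ => r ^ 2)
    rcases hw i with h | ⟨h, hle⟩
    · rw [h]; nlinarith
    · rw [h, ← sq_abs]; exact pow_le_pow_left₀ (abs_nonneg _) hle 2

/-! ### Freezing the set of components above the jump -/

open Classical in
/-- The threshold operator with the decision whether a component is thresholded made in advance:
components in `s` follow the gradient step, all others are mapped by `prox p`. -/
def frozenMap (hp : 1 ≤ p) (s : Set ι) (u : L2 ι) : L2 ι :=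
  ⟨fun i => if i ∈ s then gradStep T g u i else prox p (gradStep T g u i),
    (lp.memℓp (gradStep T g u)).mono' fun i => by
      simp only [Real.norm_eq_abs]
      split_ifs
      · exact le_rfl
      · exact abs_prox_le hp _⟩

theorem frozenMap_of_mem (hp : 1 ≤ p) {s : Set ι} {i : ι} (hi : i ∈ s) (u : L2 ι) :
    frozenMap T g hp s u i = gradStep T g u i := if_pos hi

theorem frozenMap_of_notMem (hp : 1 ≤ p) {s : Set ι} {i : ι} (hi : i ∉ s) (u : L2 ι) :
    frozenMap T g hp s u i = prox p (gradStep T g u i) := if_neg hi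

theorem norm_frozenMap_sub_le {T : L2 ι →L[ℝ] L2 κ} (hT : ‖T‖ ≤ 1) (hp : 1 ≤ p) (s : Set ι)
    (u v : L2 ι) : ‖frozenMap T g hp s u - frozenMap T g hp s v‖ ≤ ‖u - v‖ := by
  refine le_trans ?_ (norm_gradStep_sub_le g hT u v)
  rw [← sq_le_sq₀ (norm_nonneg _) (norm_nonneg _)]
  refine hasSum_le (fun i => ?_) (L2.hasSum_sq _) (L2.hasSum_sq _)
  rw [sq_le_sq, lp.coeFn_sub, lp.coeFn_sub, Pi.sub_apply, Pi.sub_apply]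
  by_cases hi : i ∈ s
  · rw [frozenMap_of_mem T g hp hi, frozenMap_of_mem T g hp hi]
  · rw [frozenMap_of_notMem T g hp hi, frozenMap_of_notMem T g hp hi]
    exact abs_prox_sub_le hp _ _

theorem thresholdMap_dichotomy (hp : 1 ≤ p) (hr : 0 < r) (u : L2 ι) (i : ι) :
    (|gradStep T g u i| ≤ jump p r ∧
      thresholdMap p r hp T g u i = prox p (gradStep T g u i) ∧
      |thresholdMap p r hp T g u i| ≤ prox p (jump p r)) ∨
    (jump p r < |gradStep T g u i| ∧ thresholdMap p r hp T g u i = gradStep T g u i) := by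
  rw [thresholdMap_apply, H_eq hr]
  split_ifs with h
  · exact Or.inl ⟨h, rfl, abs_prox_le_prox hp h⟩
  · exact Or.inr ⟨not_le.1 h, rfl⟩

/-- Asymptotic regularity and the gap between `prox p (jump p r)` and `jump p r` force the set of
components above the jump to be eventually constant along the iteration. -/
theorem exists_frozen {T : L2 ι →L[ℝ] L2 κ} (hT : ‖T‖ < 1) (hp : 1 ≤ p) (hr : 0 < r)
    {x : ℕ → L2 ι} (hx : ∀ n, x (n + 1) = thresholdMap p r hp T g (x n))
    (h0 : Summable fun i => penalty p r (x 0 i)) :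
    ∃ (N : ℕ) (s : Set ι), s.Finite ∧ ∀ n i,
      (i ∈ s → jump p r < |gradStep T g (x (N + n)) i|) ∧
      (i ∉ s → |gradStep T g (x (N + n)) i| ≤ jump p r ∧ |x (N + n) i| ≤ r) := by
  have hj0 := (jump_spec hp hr).1
  have hgap : 0 < jump p r - prox p (jump p r) := sub_pos.2 (prox_lt_self hp hj0)
  obtain ⟨M, hM⟩ := eventually_atTop.1
    ((tendsto_norm_iterate_sub g hT hp hr hx h0).eventually (gt_mem_nhds hgap))
  have hstep : ∀ n, M ≤ n → ∀ i, |x (n + 1) i - x n i| < jump p r - prox p (jump p r) :=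
    fun n hn i => (L2.abs_apply_le (x (n + 1) - x n) i).trans_lt (hM n hn)
  have hdich := fun n i => thresholdMap_dichotomy T g hp hr (x n) i
  simp only [← hx] at hdich
  -- After the first step every component has modulus at most `prox p (jump p r)` or above
  -- `jump p r`, and once the steps are shorter than the gap no component can change sides.
  have hiff : ∀ n i, (jump p r < |x (M + 1 + n) i|) ↔ jump p r < |x (M + 1) i| := by
    intro n i
    induction n with
    | zero => rfl
    | succ n ih =>
      rw [← ih]
      have h1 := hdich (M + n) i
      have h2 := hdich (M + n + 1) i
      have h3 := hstep (M + n + 1) (by omega) i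
      rw [show M + 1 + (n + 1) = M + n + 1 + 1 by omega, show M + 1 + n = M + n + 1 by omega]
      have h4 := (abs_abs_sub_abs_le_abs_sub _ _).trans_lt h3
      rw [abs_lt] at h4
      constructor
      · intro h
        rcases h1 with ⟨-, -, h1⟩ | ⟨h1, e⟩
        · linarith
        · rwa [e]
      · intro h
        rcases h2 with ⟨-, -, h2⟩ | ⟨h2, e⟩
        · linarith
        · rwa [e]
  refine ⟨M + 1, {i | jump p r < |x (M + 1) i|}, L2.finite_lt_abs _ hj0, fun n i => ?_⟩
  have hnext := hiff (n + 1) i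
  have hcur := hiff n i
  rw [show M + 1 + (n + 1) = M + 1 + n + 1 by omega] at hnext
  have h2 := hdich (M + 1 + n) i
  have h1 := hdich (M + n) i
  rw [show M + n + 1 = M + 1 + n by omega] at h1
  constructor
  · intro hi
    have hi := hnext.2 hi
    rcases h2 with ⟨-, -, h2⟩ | ⟨h2, -⟩
    · linarith
    · exact h2
  · intro hi
    constructor
    · rcases h2 with ⟨h2, -⟩ | ⟨h2, e⟩
      · exact h2
      · exact absurd (hnext.1 (e ▸ h2)) hi
    · rcases h1 with ⟨h1, e, -⟩ | ⟨h1, e⟩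
      · have : x (M + 1 + n) i = prox p (gradStep T g (x (M + n)) i) := e
        change |x (M + 1 + n) i| ≤ r
        rw [this]
        exact abs_prox_le_radius hp hr h1
      · exact absurd (hcur.1 (e ▸ h1)) hi

open Classical in
/-- The components of the gradient step are weakly continuous. -/
theorem tendsto_gradStep_apply {x : ℕ → L2 ι} {q : L2 ι}
    (h : ∀ y, Tendsto (fun n => ⟪x n, y⟫_ℝ) atTop (𝓝 ⟪q, y⟫_ℝ)) (i : ι) :
    Tendsto (fun n => gradStep T g (x n) i) atTop (𝓝 (gradStep T g q i)) := by
  have key : ∀ v : L2 ι, gradStep T g v i =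
      ⟪v, lp.single 2 i (1 : ℝ) - ContinuousLinearMap.adjoint T (T (lp.single 2 i (1 : ℝ)))⟫_ℝ +
        ContinuousLinearMap.adjoint T g i := by
    intro v
    have h1 : ⟪v, ContinuousLinearMap.adjoint T (T (lp.single 2 i (1 : ℝ)))⟫_ℝ =
        ContinuousLinearMap.adjoint T (T v) i := by
      rw [ContinuousLinearMap.adjoint_inner_right, ← ContinuousLinearMap.adjoint_inner_left,
        real_inner_comm, L2.inner_single_one]
    rw [gradStep_apply, corr, map_sub, lp.coeFn_sub, Pi.sub_apply, inner_sub_right, h1,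
      real_inner_comm, L2.inner_single_one]
    ring
  simp only [key]
  exact (h _).add_const _

/-- Once the set `s` of components that are not thresholded is frozen, the iteration is bounded. -/
theorem exists_norm_le_of_frozen (hp : 1 ≤ p) (hp2 : p ≤ 2 ∨ Finite ι) (hr : 0 < r)
    {s : Set ι} (hs : s.Finite) {x : ℕ → L2 ι}
    (hx : ∀ n, x (n + 1) = frozenMap T g hp s (x n))
    (hle : ∀ n, ∀ i ∉ s, |x n i| ≤ r)
    (hsum : ∀ n, Summable fun i => penalty p r (x n i))
    {M : ℝ} (hM : ∀ n, energy p r T g (x n) ≤ M) :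
    ∃ C, ∀ n, ‖x n‖ ≤ C := by
  have := finiteDimensional_coordSpan hs
  obtain ⟨B, hB⟩ := exists_norm_le_of_penalty_le hp2 hp hr M
  refine exists_norm_le_of_finiteDimensional T g (coordSpan s)
    (A := Real.sqrt M + ‖g‖) (B := B) (fun n => ?_) (fun n => ?_) (fun n => ?_)
  · refine lp.ext (funext fun i => ?_)
    by_cases hi : i ∈ s
    · rw [starProjection_coordSpan_of_mem _ hi, starProjection_coordSpan_of_mem _ hi, hx,
        frozenMap_of_mem T g hp hi]
      rfl
    · rw [starProjection_coordSpan_of_notMem _ hi, starProjection_coordSpan_of_notMem _ hi]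
  · have h1 : ‖T (x n) - g‖ ≤ Real.sqrt M := by
      refine Real.le_sqrt_of_sq_le (le_trans ?_ (hM n))
      exact le_add_of_nonneg_right (tsum_penalty_nonneg hr _)
    calc ‖T (x n)‖ = ‖(T (x n) - g) + g‖ := by rw [sub_add_cancel]
      _ ≤ _ := (norm_add_le _ _).trans (by linarith)
  · refine hB (x n) _ (hsum n) ?_ fun i => ?_
    · exact le_trans (le_add_of_nonneg_left (sq_nonneg _)) (hM n)
    · rw [lp.coeFn_sub, Pi.sub_apply]
      by_cases hi : i ∈ s
      · left; rw [starProjection_coordSpan_of_mem _ hi, sub_self]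
      · right
        rw [starProjection_coordSpan_of_notMem _ hi, sub_zero]
        exact ⟨rfl, hle n i hi⟩

/-- The iteration is eventually that of a frozen map, whose fixed point `q` obtained as weak limit
is a fixed point of the threshold map, except where the gradient step at `q` sits exactly on the
jump in a component of `s`. -/
theorem exists_weak_limit {T : L2 ι →L[ℝ] L2 κ} (hT : ‖T‖ < 1) (hp : 1 ≤ p)
    (hp2 : p ≤ 2 ∨ Finite ι) (hr : 0 < r) {x : ℕ → L2 ι}
    (hx : ∀ n, x (n + 1) = thresholdMap p r hp T g (x n))
    (h0 : Summable fun i => penalty p r (x 0 i)) :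
    ∃ q : L2 ι, (∀ y, Tendsto (fun n => ⟪x n, y⟫_ℝ) atTop (𝓝 ⟪q, y⟫_ℝ)) ∧
      ∀ i, thresholdMap p r hp T g q i = q i ∨ (|q i| = jump p r ∧ corr T g q i = 0) := by
  obtain ⟨N, s, hs, hfro⟩ := exists_frozen g hT hp hr hx h0
  obtain ⟨z, hz⟩ : ∃ z : ℕ → L2 ι, ∀ n, z n = x (N + n) := ⟨_, fun _ => rfl⟩
  simp only [← hz] at hfro
  have hzs : ∀ n, z (n + 1) = thresholdMap p r hp T g (z n) := fun n => by
    rw [hz, hz, ← hx]; rfl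
  have hzU : ∀ n, z (n + 1) = frozenMap T g hp s (z n) := by
    intro n
    refine lp.ext (funext fun i => ?_)
    rw [hzs, thresholdMap_apply, H_eq hr]
    by_cases hi : i ∈ s
    · rw [if_neg (not_le.2 ((hfro n i).1 hi)), frozenMap_of_mem T g hp hi]
    · rw [if_pos ((hfro n i).2 hi).1, frozenMap_of_notMem T g hp hi]
  have hz0 : Summable fun i => penalty p r (z 0 i) := by
    rw [hz]
    exact summable_penalty_iterate T g hp hr hx h0 _
  obtain ⟨C, hC⟩ := exists_norm_le_of_frozen T g hp hp2 hr hs hzU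
    (fun n i hi => ((hfro n i).2 hi).2) (summable_penalty_iterate T g hp hr hzs hz0)
    (fun n => antitone_energy_iterate g hT hp hr hzs hz0 (Nat.zero_le n))
  obtain ⟨q, hq, hlim⟩ := exists_fixedPoint_of_nonexpansive
    (norm_frozenMap_sub_le g hT.le hp s) hzU hC (tendsto_norm_iterate_sub g hT hp hr hzs hz0)
  -- The bounds that define the two kinds of components pass to the limit as weak inequalities.
  refine ⟨q, fun y => ?_, fun i => ?_⟩
  · rw [← tendsto_add_atTop_iff_nat N]
    refine (hlim y).congr fun n => ?_
    rw [hz, add_comm]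
  · have hcoord := tendsto_gradStep_apply T g hlim i
    have hqi : frozenMap T g hp s q i = q i := by rw [hq]
    rw [thresholdMap_apply, H_eq hr]
    by_cases hi : i ∈ s
    · have hge : jump p r ≤ |gradStep T g q i| :=
        ge_of_tendsto' hcoord.abs fun n => ((hfro n i).1 hi).le
      rw [frozenMap_of_mem T g hp hi] at hqi
      rcases hge.lt_or_eq with h | h
      · left; rw [if_neg (not_le.2 h), hqi]
      · right
        rw [hqi] at h
        rw [gradStep_apply] at hqi
        exact ⟨h.symm, by linarith⟩
    · have hle : |gradStep T g q i| ≤ jump p r :=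
        le_of_tendsto' hcoord.abs fun n => ((hfro n i).2 hi).1
      rw [frozenMap_of_notMem T g hp hi] at hqi
      left; rw [if_pos hle, hqi]

/-! ### Reading off the fixed point conditions -/

theorem tendsto_toWeakSpace {E : Type*} [NormedAddCommGroup E] [InnerProductSpace ℝ E]
    [CompleteSpace E] {x : ℕ → E} {q : E}
    (h : ∀ y, Tendsto (fun n => ⟪x n, y⟫_ℝ) atTop (𝓝 ⟪q, y⟫_ℝ)) :
    Tendsto (fun n => toWeakSpace ℝ E (x n)) atTop (𝓝 (toWeakSpace ℝ E q)) := by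
  refine (WeakBilin.tendsto_iff_forall_eval_tendsto (topDualPairing ℝ E).flip ?_).2 fun f => ?_
  · intro x y hxy
    exact (SeparatingDual.eq_iff_forall_dual_eq (R := ℝ)).2 fun f => DFunLike.congr_fun hxy f
  · have hf : ∀ v : E, ⟪v, (InnerProductSpace.toDual ℝ E).symm f⟫_ℝ = f v := fun v => by
      rw [real_inner_comm, InnerProductSpace.toDual_symm_apply]
    have h' := h ((InnerProductSpace.toDual ℝ E).symm f)
    rw [hf, funext fun n => hf (x n)] at h'
    exact h'

/-- The alternatives for one component `q` of the limit with residual correlation `c`. -/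
theorem limit_component_alternatives {p r : ℝ} (hp : 1 ≤ p) (hr : 0 < r) {q c : ℝ}
    (h : H p r (q + c) = q ∨ (|q| = jump p r ∧ c = 0)) :
    (|q + c| ≤ jump p r ∧ prox p (q + c) = q ∧ |q| ≤ r ∧ |q| ≤ prox p (jump p r)) ∨
      (jump p r ≤ |q| ∧ c = 0) := by
  rcases h with h | ⟨h, hc⟩
  · rw [H_eq hr] at h
    split_ifs at h with hl
    · left
      have h1 := abs_prox_le_radius hp hr hl
      have h2 := abs_prox_le_prox hp hl
      rw [h] at h1 h2
      exact ⟨hl, h, h1, h2⟩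
    · right
      have hc : c = 0 := by linarith
      rw [hc, add_zero] at hl
      exact ⟨(not_le.1 hl).le, hc⟩
  · exact Or.inr ⟨h.ge, hc⟩

theorem jumpSize_eq {p r : ℝ} (hp : 1 ≤ p) (hr : 0 < r) :
    jumpSize p r = jump p r - prox p (jump p r) := by
  have h0 := (jump_spec hp hr).1
  rw [jumpSize, H_eq hr, if_pos (abs_of_pos h0).le, abs_of_pos (sub_pos.2 (prox_lt_self hp h0))]

end FreeDiscontinuity

end

open FreeDiscontinuity in
theorem theorem3p7 {ι κ : Type*} [Countable ι] [Countable κ]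
    (p r : ℝ) (hp : 1 ≤ p) (hp2 : p ≤ 2 ∨ Finite ι) (hr : 0 < r)
    (T : L2 ι →L[ℝ] L2 κ) (hT : ‖T‖ < 1) (g : L2 κ)
    (u₀ : L2 ι) (hu₀ : J p r T g u₀ < ∞) :
    ∃ ubar : L2 ι,
      Tendsto (fun n : ℕ => toWeakSpace ℝ (L2 ι) ((thresholdMap p r hp T g)^[n] u₀)) atTop
        (𝓝 (toWeakSpace ℝ (L2 ι) ubar)) ∧
      (∀ i, thresholdMap p r hp T g ubar i = ubar i ∨
        (|ubar i| = jump p r ∧ corr T g ubar i = 0)) ∧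
      (∀ i, r < |ubar i| → jump p r ≤ |ubar i|) ∧
      (1 < p → ∀ i, |ubar i| ≤ r → |ubar i| ≤ Finv p (jump p r)) ∧
      (1 < p → ∀ i,
        (jump p r ≤ |ubar i| → corr T g ubar i = 0) ∧
        (|ubar i| ≤ jump p r - jumpSize p r → corr T g ubar i = F p (ubar i) - ubar i)) ∧
      (p = 1 → 1 / 4 ≤ r → ∀ i,
        (|ubar i| ≤ 1 / 2 → corr T g ubar i ∈ Set.Icc (-(1 / 2) : ℝ) (1 / 2)) ∧
        (1 / 2 < |ubar i| → |ubar i| ≤ r - 1 / 4 →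
          corr T g ubar i = 1 / 2 * Real.sign (ubar i)) ∧
        (r + 1 / 4 < |ubar i| → corr T g ubar i = 0)) := by
  obtain ⟨q, hlim, hfix⟩ := exists_weak_limit g hT hp hp2 hr
    (x := fun n => (thresholdMap p r hp T g)^[n] u₀)
    (fun n => Function.iterate_succ_apply' _ _ _) (summable_penalty_of_J_lt_top T g hr hu₀)
  have halt := fun i => limit_component_alternatives hp hr (by
    have h := hfix i
    rwa [thresholdMap_apply, gradStep_apply] at h)
  have hrj := lt_jump hp hr
  have hj0 := (jump_spec hp hr).1
  refine ⟨q, ?_, hfix, fun i hi => ?_, fun hp1 i hi => ?_, fun hp1 i => ⟨fun hi => ?_, fun hi => ?_⟩,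
    fun hp1 hr4 i => ?_⟩
  · exact tendsto_toWeakSpace hlim
  · rcases halt i with ⟨-, -, h, -⟩ | ⟨h, -⟩
    · exact absurd hi (not_lt.2 h)
    · exact h
  · rw [← prox_of_one_lt hp1]
    rcases halt i with ⟨-, -, -, h⟩ | ⟨h, -⟩
    · exact h
    · linarith
  · rcases halt i with ⟨-, -, h, -⟩ | ⟨-, h⟩
    · linarith
    · exact h
  · rw [jumpSize_eq hp hr, sub_sub_cancel] at hi
    rcases halt i with ⟨-, h, -, -⟩ | ⟨h, -⟩
    · rw [prox_of_one_lt hp1] at h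
      have h2 := F_Finv hp1 (q i + corr T g q i)
      rw [h] at h2
      linarith
    · linarith [prox_lt_self hp hj0]
  · subst hp1
    have hj := jump_one_of_quarter_le hr4
    rw [hj] at hrj hj0
    have halt := halt i
    rw [hj] at halt
    generalize corr T g q i = c at *
    generalize q i = t at *
    rcases halt with ⟨-, h, hle, -⟩ | ⟨h, rfl⟩
    · rcases prox_one (t + c) with ⟨h', e⟩ | ⟨h', e⟩ | ⟨h', e⟩
      · have ht : t = 0 := h.symm.trans e
        subst ht
        rw [zero_add] at h'
        refine ⟨fun _ => abs_le.1 h', fun h => ?_, fun h => ?_⟩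
        · rw [abs_zero] at h; linarith
        · linarith
      · have hc : c = 1 / 2 := by linarith
        subst hc
        refine ⟨fun _ => by norm_num, fun _ _ => ?_, fun h => by linarith⟩
        rw [Real.sign_of_pos (by linarith), mul_one]
      · have hc : c = -(1 / 2) := by linarith
        subst hc
        refine ⟨fun _ => by norm_num, fun _ _ => ?_, fun h => by linarith⟩
        rw [Real.sign_of_neg (by linarith)]; ring
    · exact ⟨fun _ => by norm_num, fun _ _ => by linarith, fun _ => rfl⟩
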